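/- **Theorem (Minimax lower bound for MAR).** Consider bandits with $n\ge 2$ arms and a mediator with values in $\{1,\dots,K\}$. Each pull of arm $a$ draws, independently of the past given the arm, a triple $(Y,O,M)$ (reward, indicator that the reward is observed, mediator) from a fixed law depending on $a$; the agent sees $M$, $O$, and sees $Y$ if and only if $O=1$. A policy $\pi$ chooses the next arm, possibly at random, as a function of all past arms and observations. With $\mu_a=\mathbb E[Y\mid a]$, the expected regret of $\pi$ on an instance $\nu$ after $T$ rounds is $\mathbb E[R_T(\pi,\nu)]=\mathbb E\big[\sum_{t=1}^T(\max_a\mu_a-\mu_{a_t})\big]$. An instance is *MAR* if $O$ is independent of $Y$ given the arm and $M$. There is a universal constant $c>0$ such that the following holds for all $n\ge2$, all $K$, and all numbers $p_{m,a}>0$ with $\sum_m p_{m,a}=1$ for every $a$, and $\gamma_{m,a}\in(0,1]$. Put $$P_a=\sum_{m}\frac{p_{m,a}}{\gamma_{m,a}},\qquad S=\frac1n\sum_a P_a,\qquad H=\frac{n}{\sum_a 1/P_a}.$$ 1. For every $T\ge0$ and every policy $\pi$ there is a MAR instance $\nu$ with $\mathbb P(M=m\mid a)=p_{m,a}$ and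 $\mathbb P(O=1\mid m,a)=\gamma_{m,a}$ for all $m,a$, such that, for all $m,a$, $\mathbb E[Y\mid m,a]\ge0$ and $Y-\mathbb E[Y\mid m,a]$ is $1$-sub-Gaussian given $(m,a)$, and $$\mathbb E[R_T(\pi,\nu)]\ \ge\ c\sqrt{T\,n\,H}.$$ 2. There is $T_0$, depending only on $n$, $K$, $(p_{m,a})$ and $(\gamma_{m,a})$, such that for every $T\ge T_0$ and every policy $\pi$ the instance $\nu$ in 1 can be chosen with $\mathbb E[Y\mid m,a]\in[0,1]$ for all $m,a$. 3. If all $\gamma_{m,a}$ are equal to one number $\gamma$, then $S=H=1/\gamma$. Hence, for every $\alpha>1$ and $T\ge1$, the rate $\sqrt{\alpha T\log(T)\,n\,S}$ of the known upper bound for MAR bandits equals $\sqrt{\alpha\log T}\cdot\sqrt{T\,n\,H}$, so that the upper and lower bounds match up to the factor $\sqrt{\alpha\log T}$ and constants. -/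

import Mathlib

open MeasureTheory ProbabilityTheory
open scoped ENNReal NNReal

namespace MissingBandit

/-- Full outcome of one pull: the reward `Y`, the indicator `O` that the reward is observed, and
the mediator `M` with values in `Fin K`. -/
abbrev Outcome (K : ℕ) : Type := ℝ × Bool × Fin K

/-- What the agent sees after a pull: the mediator and either the reward (`Sum.inl y`) or the
missing-value symbol (`Sum.inr ()`), which also tells whether the reward was observed. -/
abbrev Obs (K : ℕ) : Type := Fin K × (ℝ ⊕ Unit)

/-- One round as recorded by the agent: the arm pulled and the resulting observation. -/
abbrev Round (n K : ℕ) : Type := Fin n × Obs K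

/-- The reward `Y`. -/
def reward {K : ℕ} (ω : Outcome K) : ℝ := ω.1

/-- The indicator `O` that the reward is observed. -/
def isObs {K : ℕ} (ω : Outcome K) : Bool := ω.2.1

/-- The mediator `M`. -/
def mediator {K : ℕ} (ω : Outcome K) : Fin K := ω.2.2

/-- The part of the outcome that is revealed to the agent. -/
def observe {K : ℕ} (ω : Outcome K) : Obs K :=
  (mediator ω, if isObs ω = true then Sum.inl (reward ω) else Sum.inr ())

lemma measurable_observe {K : ℕ} : Measurable (observe (K := K)) := by
  refine Measurable.prodMk ?_ (Measurable.ite ?_ ?_ measurable_const)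
  · exact measurable_snd.comp measurable_snd
  · exact (measurable_fst.comp measurable_snd) (measurableSet_singleton true)
  · exact measurable_inl.comp measurable_fst

/-- A bandit with `n` arms, a `K`-valued fully observed mediator, and possibly missing rewards:
for every arm, the joint law of `(Y, O, M)`, with integrable reward. -/
structure Instance (n K : ℕ) where
  law : Fin n → Measure (Outcome K)
  isProbabilityMeasure : ∀ a, IsProbabilityMeasure (law a)
  integrable_reward : ∀ a, Integrable reward (law a)

namespace Instance

variable {n K : ℕ} (ν : Instance n K)

instance (a : Fin n) : IsProbabilityMeasure (ν.law a) := ν.isProbabilityMeasure a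

/-- The law of `(Y, O, M)` given arm `a` and mediator value `m`. -/
noncomputable def condLaw (m : Fin K) (a : Fin n) : Measure (Outcome K) :=
  ProbabilityTheory.cond (ν.law a) (mediator ⁻¹' {m})

/-- `p_{m,a} = P(M = m | a)`. -/
noncomputable def mediatorProb (m : Fin K) (a : Fin n) : ℝ :=
  (ν.law a).real (mediator ⁻¹' {m})

/-- `γ_{m,a} = P(O = 1 | m, a)`. -/
noncomputable def obsProb (m : Fin K) (a : Fin n) : ℝ :=
  (ν.condLaw m a).real (isObs ⁻¹' {true})

/-- `E[Y | m, a]`. -/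
noncomputable def condMean (m : Fin K) (a : Fin n) : ℝ :=
  ∫ ω, reward ω ∂(ν.condLaw m a)

/-- `μ_a = E[Y | a]`. -/
noncomputable def mean (a : Fin n) : ℝ := ∫ ω, reward ω ∂(ν.law a)

/-- The mean of an optimal arm. -/
noncomputable def bestMean : ℝ := ⨆ a, ν.mean a

/-- Missing at random: given the arm and the mediator, `O` is independent of `Y`.  (The mediator
is discrete, so one conditions on each of its values that has positive probability.) -/
def IsMAR : Prop :=
  ∀ a m, ν.mediatorProb m a ≠ 0 → IndepFun isObs reward (ν.condLaw m a)

/-- Given any arm and any mediator value, the centred reward is `1`-sub-Gaussian. -/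
def IsSubGaussian : Prop :=
  ∀ a m, HasSubgaussianMGF (fun ω => reward ω - ν.condMean m a) 1 (ν.condLaw m a)

/-- The conditional laws `P(M = m | a)` and `P(O = 1 | m, a)` are the prescribed ones. -/
def HasParams (p γ : Fin K → Fin n → ℝ) : Prop :=
  (∀ m a, ν.mediatorProb m a = p m a) ∧ ∀ m a, ν.obsProb m a = γ m a

/-- The law of the observation, as a kernel from arms. -/
noncomputable def obsKernel : Kernel (Fin n) (Obs K) :=
  Kernel.ofFunOfCountable fun a => (ν.law a).map observe

instance : IsMarkovKernel ν.obsKernel :=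
  ⟨fun a => Measure.isProbabilityMeasure_map (μ := ν.law a) measurable_observe.aemeasurable⟩

end Instance

/-- A (randomized) policy: the law of the next arm as a measurable function of all arms pulled and
all observations made so far. -/
structure Policy (n K : ℕ) where
  choose : ∀ t : ℕ, Kernel (Fin t → Round n K) (Fin n)
  isMarkovKernel : ∀ t, IsMarkovKernel (choose t)

instance {n K : ℕ} (π : Policy n K) (t : ℕ) : IsMarkovKernel (π.choose t) := π.isMarkovKernel t

/-- Append a round to a history. -/
def appendRound {n K t : ℕ} (x : (Fin t → Round n K) × Round n K) : Fin (t + 1) → Round n K :=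
  Fin.snoc (α := fun _ => Round n K) x.1 x.2

lemma measurable_appendRound {n K t : ℕ} :
    Measurable (appendRound (n := n) (K := K) (t := t)) := by
  refine measurable_pi_lambda _ fun i => ?_
  refine Fin.lastCases ?_ (fun j => ?_) i
  · simpa [appendRound] using measurable_snd
  · simp only [appendRound, Fin.snoc_castSucc]
    exact (measurable_pi_apply j).comp measurable_fst

/-- The law of the first `t` rounds when policy `π` interacts with `ν`: the next arm is drawn from
the policy given the history, then the observation is drawn from that arm, independently of the
history given the arm. -/
noncomputable def histLaw {n K : ℕ} (π : Policy n K) (ν : Instance n K) :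
    ∀ t : ℕ, Measure (Fin t → Round n K)
  | 0 => Measure.dirac Fin.elim0
  | t + 1 =>
    ((histLaw π ν t) ⊗ₘ ((π.choose t) ⊗ₖ (Kernel.prodMkLeft (Fin t → Round n K) ν.obsKernel))).map
      appendRound

instance {n K : ℕ} (π : Policy n K) (ν : Instance n K) (t : ℕ) :
    IsProbabilityMeasure (histLaw π ν t) := by
  induction t with
  | zero => unfold histLaw; infer_instance
  | succ t ih =>
    unfold histLaw
    exact Measure.isProbabilityMeasure_map measurable_appendRound.aemeasurable

/-- The cumulative regret `R_T = ∑_t (μ_{a*} - μ_{a_t})` along a history of `T` rounds. -/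
noncomputable def regret {n K : ℕ} (ν : Instance n K) {T : ℕ} (h : Fin T → Round n K) : ℝ :=
  ∑ t, (ν.bestMean - ν.mean (h t).1)

/-- The expected regret `E[R_T(π, ν)]`. -/
noncomputable def expRegret {n K : ℕ} (π : Policy n K) (ν : Instance n K) (T : ℕ) : ℝ :=
  ∫ h, regret ν h ∂(histLaw π ν T)

/-- `p m a = P(M = m | a)` and `γ m a = P(O = 1 | m, a)` are admissible: each `p · a` is a
probability vector, and both `p` and `γ` satisfy positivity. -/
structure AdmissibleParams {n K : ℕ} (p γ : Fin K → Fin n → ℝ) : Prop where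
  p_pos : ∀ m a, 0 < p m a
  p_sum : ∀ a, ∑ m, p m a = 1
  γ_pos : ∀ m a, 0 < γ m a
  γ_le_one : ∀ m a, γ m a ≤ 1

/-- `P_a = ∑_m p_{m,a} / γ_{m,a}`. -/
noncomputable def armDifficulty {n K : ℕ} (p γ : Fin K → Fin n → ℝ) (a : Fin n) : ℝ :=
  ∑ m, p m a / γ m a

/-- The arithmetic mean `S` of the `P_a`. -/
noncomputable def arithMean {n K : ℕ} (p γ : Fin K → Fin n → ℝ) : ℝ :=
  (∑ a, armDifficulty p γ a) / n

/-- The harmonic mean `H` of the `P_a`. -/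
noncomputable def harmMean {n K : ℕ} (p γ : Fin K → Fin n → ℝ) : ℝ :=
  n / ∑ a, 1 / armDifficulty p γ a

/-- The rate `√(α T log(T) n S)` of the known upper bound for MAR bandits. -/
noncomputable def upperRate {n K : ℕ} (p γ : Fin K → Fin n → ℝ) (α : ℝ) (T : ℕ) : ℝ :=
  Real.sqrt (α * T * Real.log T * n * arithMean p γ)

end MissingBandit

/-!
The lower bound compares `n` Gaussian bandits with the bandit in which every reward has mean `0`.
Under alternative `b` the mean of arm `b` is raised to a gap `Δ`, the same for all `b`, while all
other means stay `0`.  A missing reward carries no information, so one pull of arm `b` separates the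
two bandits by the Kullback–Leibler divergence `∑ m, p m b * γ m b * θ m ^ 2 / 2`, where `θ m` is
the shift given `M = m`.  Subject to `∑ m, p m b * θ m = Δ` this is least for `θ m` proportional to
`1 / γ m b` (`gapMeans`), with value `Δ ^ 2 / (2 * P_b)`: arm `b` behaves like an arm with reward
variance `P_b`.

Let `N_b` be the number of pulls of arm `b`, and let `E₀` and `E_b` be the expectations under the
zero bandit and under alternative `b`.  By `lintegral_histLaw_change_of_measure` the
likelihood ratio of a history is a product over its rounds in which the policy cancels, and by
`integral_histLaw_sum_eq_zero` its logarithm has mean `-Δ ^ 2 / (2 * P_b) * E₀[N_b]` under the zero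
bandit.  A weak form of Pinsker's inequality, obtained by integrating a pointwise inequality
(`abs_exp_sub_one_le_div_add_mul`), then bounds `E_b[N_b] - E₀[N_b]`
(`integral_pullCount_le`).  That inequality has a free weight; choosing it proportional to `1 / P_b`
lets the bounds be summed over `b` using only `∑ b, E₀[N_b] = T` and `∑ b, 1 / P_b = n / H`.
With `Δ` a small multiple of `√(n H / T)`, some `b` has `E_b[N_b] ≤ 3 T / 4`, so the regret on
alternative `b` is at least `Δ T / 4` (`exists_le_expRegret`).  As `Δ → 0` when `T → ∞`, the
conditional means are eventually at most `1`.
-/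

namespace MissingBandit

variable {n K : ℕ}

/-! ### The law of one pull with Gaussian rewards -/

lemma measurable_reward : Measurable (reward (K := K)) := measurable_fst

lemma measurable_isObs : Measurable (isObs (K := K)) := measurable_fst.comp measurable_snd

lemma measurable_mediator : Measurable (mediator (K := K)) := measurable_snd.comp measurable_snd

/-- The law of a Boolean that is `true` with probability `g`. -/
noncomputable def coinLaw (g : ℝ) : Measure Bool :=
  ENNReal.ofReal g • Measure.dirac true + ENNReal.ofReal (1 - g) • Measure.dirac false

lemma isProbabilityMeasure_coinLaw {g : ℝ} (h0 : 0 ≤ g) (h1 : g ≤ 1) :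
    IsProbabilityMeasure (coinLaw g) := by
  refine ⟨?_⟩
  simp only [coinLaw, Measure.coe_add, Measure.coe_smul, Pi.add_apply, Pi.smul_apply,
    measure_univ, smul_eq_mul, mul_one]
  rw [← ENNReal.ofReal_add h0 (by linarith)]
  simp

/-- The law of `(Y, O, M)` when `M = m` is fixed, `Y` is Gaussian with mean `θ` and variance `1`,
and `O` is an independent coin with success probability `g`. -/
noncomputable def cellLaw (θ g : ℝ) (m : Fin K) : Measure (Outcome K) :=
  (gaussianReal θ 1).prod ((coinLaw g).prod (Measure.dirac m))

lemma isProbabilityMeasure_cellLaw {g : ℝ} (h0 : 0 ≤ g) (h1 : g ≤ 1) (θ : ℝ) (m : Fin K) :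
    IsProbabilityMeasure (cellLaw θ g m) := by
  have := isProbabilityMeasure_coinLaw h0 h1
  unfold cellLaw
  infer_instance

lemma cellLaw_eq_add (θ g : ℝ) (m : Fin K) :
    cellLaw θ g m =
      ENNReal.ofReal g • (gaussianReal θ 1).map (fun y => ((y, true, m) : Outcome K)) +
        ENNReal.ofReal (1 - g) •
          (gaussianReal θ 1).map (fun y => ((y, false, m) : Outcome K)) := by
  have h : (coinLaw g).prod (Measure.dirac m) =
      ENNReal.ofReal g • Measure.dirac (true, m) +
        ENNReal.ofReal (1 - g) • Measure.dirac (false, m) := by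
    rw [Measure.prod_dirac, coinLaw, Measure.map_add _ _ (by fun_prop), Measure.map_smul,
      Measure.map_smul, Measure.map_dirac' (by fun_prop), Measure.map_dirac' (by fun_prop)]
  rw [cellLaw, h, Measure.prod_add, Measure.prod_smul_right, Measure.prod_smul_right,
    Measure.prod_dirac, Measure.prod_dirac]

lemma map_reward_cellLaw {g : ℝ} (h0 : 0 ≤ g) (h1 : g ≤ 1) (θ : ℝ) (m : Fin K) :
    (cellLaw θ g m).map reward = gaussianReal θ 1 := by
  have := isProbabilityMeasure_coinLaw h0 h1
  have h := Measure.map_fst_prod (μ := gaussianReal θ 1)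
    (ν := (coinLaw g).prod (Measure.dirac m))
  rw [measure_univ, one_smul] at h
  exact h

lemma integral_reward_cellLaw {g : ℝ} (h0 : 0 ≤ g) (h1 : g ≤ 1) (θ : ℝ) (m : Fin K) :
    ∫ ω, reward ω ∂(cellLaw θ g m) = θ := by
  have h := integral_map (μ := cellLaw θ g m) measurable_reward.aemeasurable
    (f := fun x : ℝ => x) (by fun_prop)
  rw [← h, map_reward_cellLaw h0 h1, integral_id_gaussianReal]

lemma integrable_reward_cellLaw {g : ℝ} (h0 : 0 ≤ g) (h1 : g ≤ 1) (θ : ℝ) (m : Fin K) :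
    Integrable reward (cellLaw θ g m) := by
  have h : Integrable (fun x : ℝ => x) ((cellLaw θ g m).map reward) := by
    rw [map_reward_cellLaw h0 h1]
    exact (memLp_id_gaussianReal 1).integrable (by simp)
  exact h.comp_measurable measurable_reward

lemma hasSubgaussianMGF_cellLaw {g : ℝ} (h0 : 0 ≤ g) (h1 : g ≤ 1) (θ : ℝ) (m : Fin K) :
    HasSubgaussianMGF (fun ω => reward ω - θ) 1 (cellLaw θ g m) := by
  have hmap : (cellLaw θ g m).map (fun ω => reward ω - θ) = gaussianReal 0 1 := by
    have := Measure.map_map (μ := cellLaw θ g m) (g := fun x : ℝ => x - θ) (f := reward)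
      (by fun_prop) measurable_reward
    rw [map_reward_cellLaw h0 h1, gaussianReal_map_sub_const, sub_self] at this
    exact this.symm
  refine ⟨fun t => ?_, fun t => ?_⟩
  · have h := integrable_exp_mul_gaussianReal (μ := 0) (v := 1) t
    rw [← hmap] at h
    exact h.comp_measurable (measurable_reward.sub_const θ)
  · rw [mgf_gaussianReal hmap]
    simp

lemma indepFun_cellLaw {g : ℝ} (h0 : 0 ≤ g) (h1 : g ≤ 1) (θ : ℝ) (m : Fin K) :
    IndepFun isObs reward (cellLaw θ g m) := by
  have := isProbabilityMeasure_coinLaw h0 h1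
  exact (indepFun_prod (μ := gaussianReal θ 1) (ν := (coinLaw g).prod (Measure.dirac m))
    measurable_id measurable_fst).symm

lemma cellLaw_isObs {g : ℝ} (θ : ℝ) (m : Fin K) :
    cellLaw θ g m (isObs ⁻¹' {true}) = ENNReal.ofReal g := by
  have hs : MeasurableSet (isObs (K := K) ⁻¹' {true}) :=
    measurable_isObs (measurableSet_singleton true)
  rw [cellLaw_eq_add, Measure.add_apply, Measure.smul_apply, Measure.smul_apply,
    Measure.map_apply (by fun_prop) hs, Measure.map_apply (by fun_prop) hs]
  simp [Set.preimage, isObs]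

/-- The law of one pull: the mediator has law `p`, and given `M = m` the reward is Gaussian with
mean `θ m` and variance `1`, and is observed with probability `g m` independently of its value. -/
noncomputable def pullLaw (p g θ : Fin K → ℝ) : Measure (Outcome K) :=
  ∑ m, ENNReal.ofReal (p m) • cellLaw (θ m) (g m) m

lemma cellLaw_mediator_inter {g : ℝ} (θ : ℝ) (m m' : Fin K) {t : Set (Outcome K)}
    (ht : MeasurableSet t) :
    cellLaw θ g m' (mediator ⁻¹' {m} ∩ t) = if m' = m then cellLaw θ g m' t else 0 := by
  have hs : MeasurableSet (mediator (K := K) ⁻¹' {m}) :=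
    measurable_mediator (measurableSet_singleton m)
  simp only [cellLaw_eq_add, Measure.add_apply, Measure.smul_apply,
    Measure.map_apply (show Measurable fun y : ℝ => ((y, true, m') : Outcome K) by fun_prop)
      (hs.inter ht),
    Measure.map_apply (show Measurable fun y : ℝ => ((y, false, m') : Outcome K) by fun_prop)
      (hs.inter ht),
    Measure.map_apply (show Measurable fun y : ℝ => ((y, true, m') : Outcome K) by fun_prop) ht,
    Measure.map_apply (show Measurable fun y : ℝ => ((y, false, m') : Outcome K) by fun_prop) ht]
  split_ifs with h <;> simp [Set.preimage, mediator, h]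

lemma pullLaw_mediator_inter (p g θ : Fin K → ℝ) (m : Fin K) {t : Set (Outcome K)}
    (ht : MeasurableSet t) :
    pullLaw p g θ (mediator ⁻¹' {m} ∩ t) = ENNReal.ofReal (p m) * cellLaw (θ m) (g m) m t := by
  simp [pullLaw, Measure.finsetSum_apply, cellLaw_mediator_inter _ _ _ ht]

lemma lintegral_pullLaw_observe (p g θ : Fin K → ℝ) {F : Obs K → ℝ≥0∞} (hF : Measurable F) :
    ∫⁻ o, F o ∂((pullLaw p g θ).map observe) =
      ∑ m, ENNReal.ofReal (p m) * (ENNReal.ofReal (g m) *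
        ∫⁻ y, F (m, Sum.inl y) ∂(gaussianReal (θ m) 1) +
          ENNReal.ofReal (1 - g m) * F (m, Sum.inr ())) := by
  rw [lintegral_map hF measurable_observe, pullLaw, lintegral_finsetSum_measure]
  refine Finset.sum_congr rfl fun m _ => ?_
  have hFo : Measurable fun ω : Outcome K => F (observe ω) := hF.comp measurable_observe
  rw [lintegral_smul_measure, cellLaw_eq_add, lintegral_add_measure, lintegral_smul_measure,
    lintegral_smul_measure, lintegral_map hFo (by fun_prop), lintegral_map hFo (by fun_prop)]
  simp [observe, isObs, mediator, reward]

/-! ### Likelihood ratio and divergence of one observation -/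

lemma lintegral_gaussianReal_change_mean (θ : ℝ) {F : ℝ → ℝ≥0∞} (hF : Measurable F) :
    ∫⁻ y, F y ∂(gaussianReal θ 1) =
      ∫⁻ y, ENNReal.ofReal (Real.exp (θ * y - θ ^ 2 / 2)) * F y ∂(gaussianReal 0 1) := by
  rw [gaussianReal_of_var_ne_zero _ one_ne_zero, gaussianReal_of_var_ne_zero _ one_ne_zero,
    lintegral_withDensity_eq_lintegral_mul _ (measurable_gaussianPDF _ _) hF,
    lintegral_withDensity_eq_lintegral_mul _ (measurable_gaussianPDF _ _) (by fun_prop)]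
  refine lintegral_congr fun y => ?_
  simp only [Pi.mul_apply, gaussianPDF]
  rw [← mul_assoc, ← ENNReal.ofReal_mul (gaussianPDFReal_nonneg _ _ _)]
  congr 2
  simp only [gaussianPDFReal, mul_assoc, ← Real.exp_add]
  congr 2
  simp
  ring

/-- The log-likelihood ratio of an observation between the bandit with conditional means `θ` and
the one with conditional means `0`; a missing reward carries no information. -/
noncomputable def obsLogLik (θ : Fin K → ℝ) : Obs K → ℝ
  | (m, Sum.inl y) => θ m * y - θ m ^ 2 / 2
  | (_, Sum.inr _) => 0

lemma measurable_obsLogLik (θ : Fin K → ℝ) : Measurable (obsLogLik θ) := by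
  refine measurable_from_prod_countable_right fun m => measurable_fun_sum ?_ ?_
  · exact (by fun_prop : Measurable fun y : ℝ => θ m * y - θ m ^ 2 / 2)
  · exact measurable_const

lemma lintegral_pullLaw_change_mean (p g θ : Fin K → ℝ) {F : Obs K → ℝ≥0∞}
    (hF : Measurable F) :
    ∫⁻ o, F o ∂((pullLaw p g θ).map observe) =
      ∫⁻ o, ENNReal.ofReal (Real.exp (obsLogLik θ o)) * F o
        ∂((pullLaw p g fun _ => 0).map observe) := by
  have hl := measurable_obsLogLik θ
  rw [lintegral_pullLaw_observe _ _ _ hF, lintegral_pullLaw_observe _ _ _ (by fun_prop)]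
  refine Finset.sum_congr rfl fun m _ => ?_
  rw [lintegral_gaussianReal_change_mean (θ m) (F := fun y => F (m, Sum.inl y)) (by fun_prop)]
  simp [obsLogLik]

lemma integrable_obsLogLik (p g θ : Fin K → ℝ) :
    Integrable (obsLogLik θ) ((pullLaw p g fun _ => 0).map observe) := by
  refine ⟨(measurable_obsLogLik θ).aestronglyMeasurable, ?_⟩
  have hl := measurable_obsLogLik θ
  rw [HasFiniteIntegral, lintegral_pullLaw_observe _ _ _ (by fun_prop)]
  refine ENNReal.sum_lt_top.2 fun m _ => ENNReal.mul_lt_top ENNReal.ofReal_lt_top ?_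
  have h : Integrable (fun y : ℝ => θ m * y - θ m ^ 2 / 2) (gaussianReal 0 1) :=
    (((memLp_id_gaussianReal 1).integrable (by simp)).const_mul _).sub (integrable_const _)
  simpa [obsLogLik] using ENNReal.mul_lt_top ENNReal.ofReal_lt_top h.2

/-- The expected log-likelihood ratio of one pull is minus the Kullback–Leibler divergence: a
reward shifted by `θ m` contributes `θ m ^ 2 / 2`, weighted by the chance of observing it. -/
lemma integral_obsLogLik {p g : Fin K → ℝ} (hp : ∀ m, 0 ≤ p m) (hg : ∀ m, 0 ≤ g m)
    (θ : Fin K → ℝ) :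
    ∫ o, obsLogLik θ o ∂((pullLaw p g fun _ => 0).map observe) =
      -∑ m, p m * g m * (θ m ^ 2 / 2) := by
  have hl := measurable_obsLogLik θ
  have h0 : Integrable (fun y : ℝ => y) (gaussianReal 0 1) :=
    (memLp_id_gaussianReal 1).integrable (by simp)
  have hlo : Measurable fun ω : Outcome K => obsLogLik θ (observe ω) := hl.comp measurable_observe
  have h1 (m : Fin K) : Integrable (fun ω => obsLogLik θ (observe ω))
      ((gaussianReal 0 1).map fun y => ((y, true, m) : Outcome K)) := by
    rw [integrable_map_measure hlo.aestronglyMeasurable (by fun_prop)]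
    exact (h0.const_mul (θ m)).sub (integrable_const (θ m ^ 2 / 2))
  have h2 (m : Fin K) : Integrable (fun ω => obsLogLik θ (observe ω))
      ((gaussianReal 0 1).map fun y => ((y, false, m) : Outcome K)) := by
    rw [integrable_map_measure hlo.aestronglyMeasurable (by fun_prop)]
    exact integrable_const (0 : ℝ)
  rw [integral_map measurable_observe.aemeasurable hl.aestronglyMeasurable, pullLaw,
    integral_finsetSum_measure, ← Finset.sum_neg_distrib]
  · refine Finset.sum_congr rfl fun m _ => ?_
    have e1 : ∫ y, (θ m * y - θ m ^ 2 / 2) ∂(gaussianReal 0 1) = -(θ m ^ 2 / 2) := by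
      rw [integral_sub (h0.const_mul _) (integrable_const _), integral_const_mul,
        integral_id_gaussianReal]
      simp
    rw [integral_smul_measure, cellLaw_eq_add,
      integral_add_measure ((h1 m).smul_measure ENNReal.ofReal_ne_top)
        ((h2 m).smul_measure ENNReal.ofReal_ne_top),
      integral_smul_measure, integral_smul_measure,
      integral_map (by fun_prop) hlo.aestronglyMeasurable,
      integral_map (by fun_prop) hlo.aestronglyMeasurable]
    simp [observe, isObs, mediator, reward, obsLogLik, e1, ENNReal.toReal_ofReal (hp m),
      ENNReal.toReal_ofReal (hg m), mul_assoc]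
  · intro m _
    rw [cellLaw_eq_add]
    exact (((h1 m).smul_measure ENNReal.ofReal_ne_top).add_measure
      ((h2 m).smul_measure ENNReal.ofReal_ne_top)).smul_measure ENNReal.ofReal_ne_top

/-! ### Gaussian bandits with prescribed parameters -/

lemma integrable_reward_pullLaw {p g : Fin K → ℝ} (h0 : ∀ m, 0 ≤ g m) (h1 : ∀ m, g m ≤ 1)
    (θ : Fin K → ℝ) : Integrable reward (pullLaw p g θ) :=
  integrable_finsetSum_measure.2 fun m _ =>
    (integrable_reward_cellLaw (h0 m) (h1 m) (θ m) m).smul_measure ENNReal.ofReal_ne_top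

lemma integral_reward_pullLaw {p g : Fin K → ℝ} (hp : ∀ m, 0 ≤ p m) (h0 : ∀ m, 0 ≤ g m)
    (h1 : ∀ m, g m ≤ 1) (θ : Fin K → ℝ) :
    ∫ ω, reward ω ∂(pullLaw p g θ) = ∑ m, p m * θ m := by
  rw [pullLaw, integral_finsetSum_measure fun m _ =>
    (integrable_reward_cellLaw (h0 m) (h1 m) (θ m) m).smul_measure ENNReal.ofReal_ne_top]
  refine Finset.sum_congr rfl fun m _ => ?_
  rw [integral_smul_measure, integral_reward_cellLaw (h0 m) (h1 m),
    ENNReal.toReal_ofReal (hp m), smul_eq_mul]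

lemma isProbabilityMeasure_pullLaw {p g : Fin K → ℝ} (hp : ∀ m, 0 ≤ p m) (hs : ∑ m, p m = 1)
    (h0 : ∀ m, 0 ≤ g m) (h1 : ∀ m, g m ≤ 1) (θ : Fin K → ℝ) :
    IsProbabilityMeasure (pullLaw p g θ) := by
  have hc (m : Fin K) := isProbabilityMeasure_cellLaw (h0 m) (h1 m) (θ m) m
  refine ⟨?_⟩
  simp only [pullLaw, Measure.finsetSum_apply, Measure.smul_apply, measure_univ, smul_eq_mul,
    mul_one]
  rw [← ENNReal.ofReal_sum_of_nonneg fun m _ => hp m, hs, ENNReal.ofReal_one]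

/-- The bandit with parameters `p`, `γ` in which the reward, given arm `a` and mediator value `m`,
is Gaussian with mean `θ m a` and variance `1`, and independent of its being observed. -/
noncomputable def gaussianBandit {p γ : Fin K → Fin n → ℝ} (h : AdmissibleParams p γ)
    (θ : Fin K → Fin n → ℝ) : Instance n K where
  law a := pullLaw (fun m => p m a) (fun m => γ m a) fun m => θ m a
  isProbabilityMeasure a := isProbabilityMeasure_pullLaw (fun m => (h.p_pos m a).le) (h.p_sum a)
    (fun m => (h.γ_pos m a).le) (fun m => h.γ_le_one m a) _
  integrable_reward a := integrable_reward_pullLaw (fun m => (h.γ_pos m a).le)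
    (fun m => h.γ_le_one m a) _

section gaussianBandit

variable {p γ : Fin K → Fin n → ℝ} (h : AdmissibleParams p γ) (θ : Fin K → Fin n → ℝ)

lemma gaussianBandit_mediator (m : Fin K) (a : Fin n) :
    (gaussianBandit h θ).law a (mediator ⁻¹' {m}) = ENNReal.ofReal (p m a) := by
  have := isProbabilityMeasure_cellLaw (h.γ_pos m a).le (h.γ_le_one m a) (θ m a) m
  have := pullLaw_mediator_inter (fun m => p m a) (fun m => γ m a) (fun m => θ m a) m
    MeasurableSet.univ
  rwa [Set.inter_univ, measure_univ, mul_one] at this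

lemma gaussianBandit_condLaw (m : Fin K) (a : Fin n) :
    (gaussianBandit h θ).condLaw m a = cellLaw (θ m a) (γ m a) m := by
  have hs : MeasurableSet (mediator (K := K) ⁻¹' {m}) :=
    measurable_mediator (measurableSet_singleton m)
  ext t ht
  rw [Instance.condLaw, cond_apply hs, gaussianBandit_mediator]
  change _ * pullLaw _ _ _ _ = _
  rw [pullLaw_mediator_inter _ _ _ _ ht, ← mul_assoc,
    ENNReal.inv_mul_cancel (by simpa using h.p_pos m a) ENNReal.ofReal_ne_top, one_mul]

lemma gaussianBandit_isMAR : (gaussianBandit h θ).IsMAR := fun a m _ => by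
  rw [gaussianBandit_condLaw]
  exact indepFun_cellLaw (h.γ_pos m a).le (h.γ_le_one m a) _ _

lemma gaussianBandit_hasParams : (gaussianBandit h θ).HasParams p γ := by
  refine ⟨fun m a => ?_, fun m a => ?_⟩
  · rw [Instance.mediatorProb, measureReal_def, gaussianBandit_mediator,
      ENNReal.toReal_ofReal (h.p_pos m a).le]
  · rw [Instance.obsProb, measureReal_def, gaussianBandit_condLaw, cellLaw_isObs,
      ENNReal.toReal_ofReal (h.γ_pos m a).le]

lemma gaussianBandit_condMean (m : Fin K) (a : Fin n) :
    (gaussianBandit h θ).condMean m a = θ m a := by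
  rw [Instance.condMean, gaussianBandit_condLaw,
    integral_reward_cellLaw (h.γ_pos m a).le (h.γ_le_one m a)]

lemma gaussianBandit_isSubGaussian : (gaussianBandit h θ).IsSubGaussian := fun a m => by
  rw [gaussianBandit_condLaw, gaussianBandit_condMean]
  exact hasSubgaussianMGF_cellLaw (h.γ_pos m a).le (h.γ_le_one m a) _ _

lemma gaussianBandit_mean (a : Fin n) : (gaussianBandit h θ).mean a = ∑ m, p m a * θ m a :=
  integral_reward_pullLaw (fun m => (h.p_pos m a).le) (fun m => (h.γ_pos m a).le)
    (fun m => h.γ_le_one m a) _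

end gaussianBandit

/-! ### Laws of histories -/

section history

variable (π : Policy n K) (ν : Instance n K)

lemma lintegral_roundKernel {t : ℕ} (h : Fin t → Round n K) {F : Round n K → ℝ≥0∞}
    (hF : Measurable F) :
    ∫⁻ r, F r ∂((π.choose t ⊗ₖ Kernel.prodMkLeft (Fin t → Round n K) ν.obsKernel) h) =
      ∫⁻ a, ∫⁻ o, F (a, o) ∂(ν.obsKernel a) ∂(π.choose t h) := by
  rw [Kernel.lintegral_compProd _ _ _ hF]
  simp only [Kernel.prodMkLeft_apply]

lemma lintegral_histLaw_succ {t : ℕ} {F : (Fin (t + 1) → Round n K) → ℝ≥0∞}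
    (hF : Measurable F) :
    ∫⁻ h, F h ∂(histLaw π ν (t + 1)) =
      ∫⁻ h, ∫⁻ a, ∫⁻ o, F (appendRound (h, (a, o))) ∂(ν.obsKernel a) ∂(π.choose t h)
        ∂(histLaw π ν t) := by
  have hG : Measurable fun x => F (appendRound (n := n) (K := K) (t := t) x) :=
    hF.comp measurable_appendRound
  rw [histLaw, lintegral_map hF measurable_appendRound, Measure.lintegral_compProd hG]
  exact lintegral_congr fun h => lintegral_roundKernel π ν h (hG.comp measurable_prodMk_left)

lemma sum_appendRound {t : ℕ} (f : Round n K → ℝ) (h : Fin t → Round n K) (r : Round n K) :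
    ∑ s, f (appendRound (h, r) s) = ∑ s, f (h s) + f r := by
  simp [Fin.sum_univ_castSucc, appendRound]

variable {ν}

/-- If each observation law of `ν'` has density `exp ∘ l` with respect to that of `ν`, then the
likelihood ratio of a history is the exponential of the sum of `l` over its rounds: the policy,
being the same for both bandits, cancels. -/
lemma lintegral_histLaw_change_of_measure {ν' : Instance n K} {l : Round n K → ℝ}
    (hl : Measurable l)
    (hden : ∀ (a : Fin n) (F : Obs K → ℝ≥0∞), Measurable F → ∫⁻ o, F o ∂(ν'.obsKernel a) =
      ∫⁻ o, ENNReal.ofReal (Real.exp (l (a, o))) * F o ∂(ν.obsKernel a)) (t : ℕ)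
    {F : (Fin t → Round n K) → ℝ≥0∞} (hF : Measurable F) :
    ∫⁻ h, F h ∂(histLaw π ν' t) =
      ∫⁻ h, ENNReal.ofReal (Real.exp (∑ s, l (h s))) * F h ∂(histLaw π ν t) := by
  induction t with
  | zero => simp [histLaw]
  | succ t ih =>
    have hG : Measurable fun x => F (appendRound (n := n) (K := K) (t := t) x) :=
      hF.comp measurable_appendRound
    have hGh (h : Fin t → Round n K) : Measurable fun r => F (appendRound (h, r)) :=
      hG.comp measurable_prodMk_left
    have hGa (h : Fin t → Round n K) (a : Fin n) :
        Measurable fun o => F (appendRound (h, (a, o))) :=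
      (hGh h).comp measurable_prodMk_left
    have hI : Measurable fun h : Fin t → Round n K =>
        ∫⁻ a, ∫⁻ o, F (appendRound (h, (a, o))) ∂(ν'.obsKernel a) ∂(π.choose t h) := by
      rw [← funext fun h => lintegral_roundKernel π ν' h (hGh h)]
      exact hG.lintegral_kernel_prod_right'
    rw [lintegral_histLaw_succ π ν' hF, lintegral_histLaw_succ π ν (by fun_prop), ih hI]
    refine lintegral_congr fun h => ?_
    have e1 : ∀ a, ∫⁻ o, F (appendRound (h, (a, o))) ∂(ν'.obsKernel a) = _ :=
      fun a => hden a _ (hGa h a)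
    simp_rw [e1, sum_appendRound, Real.exp_add, ENNReal.ofReal_mul (Real.exp_pos _).le, mul_assoc]
    rw [← lintegral_const_mul _ .of_discrete]
    refine lintegral_congr fun a => ?_
    have hla : Measurable fun o => ENNReal.ofReal (Real.exp (l (a, o))) := by fun_prop
    exact (lintegral_const_mul _ (hla.mul (hGa h a))).symm

/-- A function of a round whose conditional mean given the arm vanishes has vanishing expected
sum along a history, since the arm is chosen before the observation is drawn. -/
lemma integral_histLaw_sum_eq_zero {f : Round n K → ℝ} (hf : Measurable f)
    (hint : ∀ a, Integrable (fun o => f (a, o)) (ν.obsKernel a))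
    (hzero : ∀ a, ∫ o, f (a, o) ∂(ν.obsKernel a) = 0) (t : ℕ) :
    Integrable (fun h : Fin t → Round n K => ∑ s, f (h s)) (histLaw π ν t) ∧
      ∫ h, ∑ s, f (h s) ∂(histLaw π ν t) = 0 := by
  induction t with
  | zero => simp
  | succ t ih =>
    set κ := π.choose t ⊗ₖ Kernel.prodMkLeft (Fin t → Round n K) ν.obsKernel with hκ
    set C : ℝ≥0∞ := ∑ a, ∫⁻ o, ‖f (a, o)‖ₑ ∂(ν.obsKernel a) with hC
    have hCtop : C < ∞ := ENNReal.sum_lt_top.2 fun a _ => (hint a).2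
    have hle (h : Fin t → Round n K) : ∫⁻ r, ‖f r‖ₑ ∂(κ h) ≤ C := by
      rw [hκ, lintegral_roundKernel π ν h (by fun_prop)]
      calc _ ≤ ∫⁻ _, C ∂(π.choose t h) := lintegral_mono fun a =>
            Finset.single_le_sum (f := fun a => ∫⁻ o, ‖f (a, o)‖ₑ ∂(ν.obsKernel a))
              (fun _ _ => zero_le) (Finset.mem_univ a)
        _ = C := by simp
    have hκint (h : Fin t → Round n K) : Integrable f (κ h) :=
      ⟨hf.aestronglyMeasurable, (hle h).trans_lt hCtop⟩
    have hκzero (h : Fin t → Round n K) : ∫ r, f r ∂(κ h) = 0 := by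
      rw [hκ, ProbabilityTheory.integral_compProd (hκint h)]
      simp [Kernel.prodMkLeft_apply, hzero]
    have hlast : Integrable (fun x : (Fin t → Round n K) × Round n K => f x.2)
        (histLaw π ν t ⊗ₘ κ) := by
      refine ⟨(hf.comp measurable_snd).aestronglyMeasurable, ?_⟩
      rw [HasFiniteIntegral, Measure.lintegral_compProd (by fun_prop)]
      calc _ ≤ ∫⁻ _, C ∂(histLaw π ν t) := lintegral_mono hle
        _ < ∞ := by simpa using hCtop
    have hfst : (histLaw π ν t ⊗ₘ κ).map Prod.fst = histLaw π ν t :=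
      Measure.fst_compProd _ _
    have hsum : Measurable fun h : Fin t → Round n K => ∑ s, f (h s) := by fun_prop
    have hpast : Integrable (fun x : (Fin t → Round n K) × Round n K => ∑ s, f (x.1 s))
        (histLaw π ν t ⊗ₘ κ) := by
      have := ih.1
      rw [← hfst] at this
      exact this.comp_measurable measurable_fst
    have hsum' : Measurable fun h : Fin (t + 1) → Round n K => ∑ s, f (h s) := by fun_prop
    have happ : (fun x : (Fin t → Round n K) × Round n K => ∑ s, f (appendRound x s)) =
        fun x => ∑ s, f (x.1 s) + f x.2 := funext fun x => sum_appendRound f x.1 x.2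
    rw [histLaw, ← hκ]
    constructor
    · rw [integrable_map_measure hsum'.aestronglyMeasurable measurable_appendRound.aemeasurable]
      change Integrable (fun x => ∑ s, f (appendRound x s)) _
      rw [happ]
      exact hpast.add hlast
    · rw [integral_map measurable_appendRound.aemeasurable hsum'.aestronglyMeasurable, happ,
        integral_add hpast hlast, Measure.integral_compProd hlast]
      have e := integral_map (μ := histLaw π ν t ⊗ₘ κ) measurable_fst.aemeasurable
        (f := fun h : Fin t → Round n K => ∑ s, f (h s)) hsum.aestronglyMeasurable
      rw [hfst, ih.2] at e
      simp [← e, hκzero]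

end history

/-! ### From divergence to expectations -/

/-- The pointwise form of the bound of the total variation distance by the Kullback–Leibler
divergence, for a likelihood ratio `exp x`.  It comes from
`|exp x - 1| = |exp (x / 2) - 1| * (exp (x / 2) + 1)` and the inequality of arithmetic and geometric
means with weight `s`. -/
lemma abs_exp_sub_one_le_div_add_mul (x : ℝ) {s : ℝ} (hs : 0 < s) :
    |Real.exp x - 1| ≤ (Real.exp x - 1 - x) / (2 * s) + s * (1 + Real.exp x) := by
  set u := Real.exp (x / 2) with hu
  have hx : Real.exp x = u ^ 2 := by rw [hu, ← Real.exp_nat_mul]; congr 1; push_cast; ring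
  have hu0 : 0 < u := Real.exp_pos _
  have hux : x / 2 + 1 ≤ u := Real.add_one_le_exp _
  rw [hx]
  have h1 : |u ^ 2 - 1| = |u - 1| * (u + 1) := by
    rw [show u ^ 2 - 1 = (u - 1) * (u + 1) by ring, abs_mul,
      abs_of_pos (show 0 < u + 1 by linarith)]
  have h2 : (u - 1) ^ 2 / (2 * s) ≤ (u ^ 2 - 1 - x) / (2 * s) := by
    gcongr
    nlinarith
  have h3 : s / 2 * (u + 1) ^ 2 ≤ s * (1 + u ^ 2) := by
    nlinarith [mul_nonneg hs.le (sq_nonneg (u - 1))]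
  have h4 : |u - 1| * (u + 1) ≤ (u - 1) ^ 2 / (2 * s) + s / 2 * (u + 1) ^ 2 := by
    have h5 : (u - 1) ^ 2 / (2 * s) + s / 2 * (u + 1) ^ 2 - |u - 1| * (u + 1) =
        (|u - 1| - s * (u + 1)) ^ 2 / (2 * s) := by
      rw [← sq_abs (u - 1)]
      field_simp
      ring
    have h6 : 0 ≤ (|u - 1| - s * (u + 1)) ^ 2 / (2 * s) := by positivity
    linarith
  linarith

/-- A change of measure with log-likelihood ratio `l` moves the mean of a `[0, B]`-valued function
by at most `B` times a bound on the total variation distance; `-∫ l` is the Kullback–Leibler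
divergence, and `s` is free. -/
lemma integral_le_of_logLik {X : Type*} [MeasurableSpace X] {μ μ' : Measure X}
    [IsProbabilityMeasure μ] [IsProbabilityMeasure μ'] {l : X → ℝ} (hl : Measurable l)
    (hli : Integrable l μ)
    (hden : ∀ F : X → ℝ≥0∞, Measurable F →
      ∫⁻ x, F x ∂μ' = ∫⁻ x, ENNReal.ofReal (Real.exp (l x)) * F x ∂μ)
    {N : X → ℝ} (hN : Measurable N) {B : ℝ} (h0 : ∀ x, 0 ≤ N x) (hB : ∀ x, N x ≤ B)
    {s : ℝ} (hs : 0 < s) :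
    ∫ x, N x ∂μ' ≤ ∫ x, N x ∂μ + B * ((-∫ x, l x ∂μ) / (2 * s) + 2 * s) := by
  have hmass : ∫⁻ x, ENNReal.ofReal (Real.exp (l x)) ∂μ = 1 := by
    simpa using (hden (fun _ => 1) measurable_const).symm
  have hLi : Integrable (fun x => Real.exp (l x)) μ := by
    refine ⟨by fun_prop, ?_⟩
    rw [hasFiniteIntegral_iff_ofReal (.of_forall fun x => (Real.exp_pos _).le), hmass]
    exact ENNReal.one_lt_top
  have hL1 : ∫ x, Real.exp (l x) ∂μ = 1 := by
    rw [integral_eq_lintegral_of_nonneg_ae (.of_forall fun x => (Real.exp_pos _).le)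
      hLi.aestronglyMeasurable, hmass, ENNReal.toReal_one]
  have hNμ : Integrable N μ := .of_bound hN.aestronglyMeasurable B
    (.of_forall fun x => by rw [Real.norm_of_nonneg (h0 x)]; exact hB x)
  have hLN : ∫ x, N x ∂μ' = ∫ x, Real.exp (l x) * N x ∂μ := by
    rw [integral_eq_lintegral_of_nonneg_ae (.of_forall h0) hN.aestronglyMeasurable,
      integral_eq_lintegral_of_nonneg_ae
        (.of_forall fun x => mul_nonneg (Real.exp_pos _).le (h0 x)) (by fun_prop),
      hden _ (by fun_prop)]
    simp_rw [ENNReal.ofReal_mul (Real.exp_pos _).le]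
  have hL' : Integrable (fun x => Real.exp (l x) - 1) μ := hLi.sub (integrable_const 1)
  have hb : Integrable (fun x => (Real.exp (l x) - 1 - l x) / (2 * s)) μ :=
    (hL'.sub hli).div_const _
  have hc : Integrable (fun x => s * (1 + Real.exp (l x))) μ :=
    ((integrable_const 1).add hLi).const_mul s
  have hbc : Integrable (fun x => B * ((Real.exp (l x) - 1 - l x) / (2 * s) +
      s * (1 + Real.exp (l x)))) μ := (hb.add hc).const_mul B
  have hle : ∫ x, Real.exp (l x) * N x ∂μ ≤ ∫ x, (N x + B * ((Real.exp (l x) - 1 - l x) / (2 * s) +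
      s * (1 + Real.exp (l x)))) ∂μ := by
    refine integral_mono (hLi.mul_bdd (c := B) hN.aestronglyMeasurable (.of_forall fun x => by
      rw [Real.norm_of_nonneg (h0 x)]; exact hB x)) (hNμ.add hbc) fun x => ?_
    have h1 := abs_exp_sub_one_le_div_add_mul (l x) hs
    have h2 : (Real.exp (l x) - 1) * N x ≤ |Real.exp (l x) - 1| * B :=
      mul_le_mul (le_abs_self _) (hB x) (h0 x) (abs_nonneg _)
    have h3 := mul_le_mul_of_nonneg_left h1 ((h0 x).trans (hB x))
    linarith
  rw [hLN]
  refine hle.trans_eq ?_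
  rw [integral_add hNμ hbc, integral_const_mul, integral_add hb hc,
    integral_div, integral_const_mul, integral_add (integrable_const 1) hLi,
    integral_sub hL' hli, integral_sub hLi (integrable_const 1), hL1]
  simp
  left
  ring

/-! ### Pull counts -/

/-- The number of pulls of arm `b` along a history. -/
noncomputable def pullCount {T : ℕ} (b : Fin n) (h : Fin T → Round n K) : ℝ :=
  ∑ t, if (h t).1 = b then 1 else 0

lemma measurable_armIndicator (b : Fin n) :
    Measurable fun r : Round n K => if r.1 = b then (1 : ℝ) else 0 :=
  Measurable.ite (measurable_fst (measurableSet_singleton b)) measurable_const measurable_const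

lemma measurable_pullCount {T : ℕ} (b : Fin n) :
    Measurable (pullCount (K := K) (T := T) b) :=
  Finset.measurable_sum _ fun t _ => (measurable_armIndicator b).comp (measurable_pi_apply t)

lemma pullCount_nonneg {T : ℕ} (b : Fin n) (h : Fin T → Round n K) : 0 ≤ pullCount b h :=
  Finset.sum_nonneg fun t _ => by split_ifs <;> simp

lemma pullCount_le {T : ℕ} (b : Fin n) (h : Fin T → Round n K) : pullCount b h ≤ T := by
  calc pullCount b h ≤ ∑ _t : Fin T, (1 : ℝ) :=
        Finset.sum_le_sum fun t _ => by split_ifs <;> simp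
    _ = T := by simp

lemma sum_pullCount {T : ℕ} (h : Fin T → Round n K) : ∑ b, pullCount b h = T := by
  simp only [pullCount]
  rw [Finset.sum_comm]
  simp

lemma integrable_pullCount {T : ℕ} (b : Fin n) (μ : Measure (Fin T → Round n K))
    [IsFiniteMeasure μ] : Integrable (pullCount b) μ :=
  .of_bound (measurable_pullCount b).aestronglyMeasurable (T : ℝ) (.of_forall fun h => by
    rw [Real.norm_of_nonneg (pullCount_nonneg b h)]; exact pullCount_le b h)

/-! ### The alternatives and their regret -/

section alternatives

variable {p γ : Fin K → Fin n → ℝ}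

/-- Conditional means under which arm `b` has mean `Δ` and every other arm has mean `0`.  Among all
ways to spread the gap `Δ` over the mediator values, `θ m ∝ 1 / γ m b` is the one of least
Kullback–Leibler divergence from the zero bandit. -/
noncomputable def gapMeans (p γ : Fin K → Fin n → ℝ) (Δ : ℝ) (b : Fin n) (m : Fin K) (a : Fin n) :
    ℝ :=
  if a = b then Δ / (γ m b * armDifficulty p γ b) else 0

lemma armDifficulty_pos (h : AdmissibleParams p γ) (a : Fin n) : 0 < armDifficulty p γ a := by
  refine Finset.sum_pos (fun m _ => div_pos (h.p_pos m a) (h.γ_pos m a)) ?_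
  by_contra hne
  have := h.p_sum a
  rw [Finset.not_nonempty_iff_eq_empty.1 hne] at this
  simp at this

lemma sum_mul_gapMeans (h : AdmissibleParams p γ) (Δ : ℝ) (b a : Fin n) :
    ∑ m, p m a * gapMeans p γ Δ b m a = if a = b then Δ else 0 := by
  unfold gapMeans
  split_ifs with hab
  · subst hab
    have hP := armDifficulty_pos h a
    calc _ = ∑ m, p m a / γ m a * (Δ / armDifficulty p γ a) :=
          Finset.sum_congr rfl fun m _ => by field_simp
      _ = Δ := by
          rw [← Finset.sum_mul]
          change armDifficulty p γ a * _ = _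
          field_simp
  · simp

lemma sum_mul_sq_gapMeans (h : AdmissibleParams p γ) (Δ : ℝ) (b a : Fin n) :
    ∑ m, p m a * γ m a * (gapMeans p γ Δ b m a ^ 2 / 2) =
      if a = b then Δ ^ 2 / (2 * armDifficulty p γ b) else 0 := by
  unfold gapMeans
  split_ifs with hab
  · subst hab
    have hP := armDifficulty_pos h a
    calc _ = ∑ m, p m a / γ m a * (Δ ^ 2 / (2 * armDifficulty p γ a ^ 2)) :=
          Finset.sum_congr rfl fun m _ => by
            have := h.γ_pos m a
            field_simp
      _ = _ := by
          rw [← Finset.sum_mul]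
          change armDifficulty p γ a * _ = _
          field_simp
  · simp

/-- Raising the mean of arm `b` to `Δ` changes the expected number of its pulls by a quantity
controlled by the Kullback–Leibler divergence `Δ ^ 2 / (2 * P_b)` per pull. -/
lemma integral_pullCount_le (h : AdmissibleParams p γ) (π : Policy n K) (T : ℕ) (Δ : ℝ) (b : Fin n)
    {s : ℝ} (hs : 0 < s) :
    ∫ x, pullCount b x ∂(histLaw π (gaussianBandit h (gapMeans p γ Δ b)) T) ≤
      ∫ x, pullCount b x ∂(histLaw π (gaussianBandit h fun _ _ => 0) T) +
        T * (Δ ^ 2 / (2 * armDifficulty p γ b) *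
          (∫ x, pullCount b x ∂(histLaw π (gaussianBandit h fun _ _ => 0) T)) / (2 * s) +
            2 * s) := by
  set ν₀ := gaussianBandit h fun _ _ => 0 with hν₀
  set kl : ℝ := Δ ^ 2 / (2 * armDifficulty p γ b) with hkl
  let l : Round n K → ℝ := fun r => obsLogLik (fun m => gapMeans p γ Δ b m r.1) r.2
  have hl : Measurable l := measurable_from_prod_countable_right fun a =>
    measurable_obsLogLik fun m => gapMeans p γ Δ b m a
  let f : Round n K → ℝ := fun r => l r + kl * if r.1 = b then 1 else 0
  have hf : Measurable f := hl.add ((measurable_armIndicator b).const_mul kl)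
  have hlint (a : Fin n) : Integrable (fun o => l (a, o)) (ν₀.obsKernel a) :=
    integrable_obsLogLik (fun m => p m a) (fun m => γ m a) fun m => gapMeans p γ Δ b m a
  have hfint (a : Fin n) : Integrable (fun o => f (a, o)) (ν₀.obsKernel a) :=
    (hlint a).add (integrable_const (kl * if a = b then 1 else 0))
  have hfzero (a : Fin n) : ∫ o, f (a, o) ∂(ν₀.obsKernel a) = 0 := by
    have e : ∫ o, l (a, o) ∂(ν₀.obsKernel a) = _ := integral_obsLogLik
      (fun m => (h.p_pos m a).le) (fun m => (h.γ_pos m a).le) fun m => gapMeans p γ Δ b m a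
    change ∫ o, (l (a, o) + kl * if a = b then 1 else 0) ∂(ν₀.obsKernel a) = 0
    rw [integral_add (hlint a) (integrable_const _), e, sum_mul_sq_gapMeans h]
    split_ifs <;> simp [hkl]
  obtain ⟨hSint, hSzero⟩ := integral_histLaw_sum_eq_zero π hf hfint hfzero T
  have hsum (x : Fin T → Round n K) :
      ∑ t, l (x t) = ∑ t, f (x t) - kl * pullCount b x := by
    simp only [f, pullCount, Finset.sum_add_distrib, Finset.mul_sum]
    ring
  have hNint := integrable_pullCount b (histLaw π ν₀ T)
  have hLint : Integrable (fun x : Fin T → Round n K => ∑ t, l (x t)) (histLaw π ν₀ T) := by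
    simp_rw [hsum]
    exact hSint.sub (hNint.const_mul kl)
  have hLval : -∫ x, ∑ t, l (x t) ∂(histLaw π ν₀ T) =
      kl * ∫ x, pullCount b x ∂(histLaw π ν₀ T) := by
    simp_rw [hsum]
    rw [integral_sub hSint (hNint.const_mul kl), hSzero, integral_const_mul]
    ring
  have hden (a : Fin n) (F : Obs K → ℝ≥0∞) (hF : Measurable F) :
      ∫⁻ o, F o ∂((gaussianBandit h (gapMeans p γ Δ b)).obsKernel a) =
        ∫⁻ o, ENNReal.ofReal (Real.exp (l (a, o))) * F o ∂(ν₀.obsKernel a) :=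
    lintegral_pullLaw_change_mean (fun m => p m a) (fun m => γ m a)
      (fun m => gapMeans p γ Δ b m a) hF
  have key := integral_le_of_logLik (μ' := histLaw π (gaussianBandit h (gapMeans p γ Δ b)) T)
    (by fun_prop) hLint
    (fun F hF => lintegral_histLaw_change_of_measure π (ν := ν₀) hl hden T hF)
    (measurable_pullCount b) (pullCount_nonneg b) (pullCount_le b) hs
  rw [hLval] at key
  exact key

lemma le_expRegret_gapMeans (h : AdmissibleParams p γ) (π : Policy n K) (T : ℕ) (Δ : ℝ)
    (b : Fin n) :
    Δ * (T - ∫ x, pullCount b x ∂(histLaw π (gaussianBandit h (gapMeans p γ Δ b)) T)) ≤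
      expRegret π (gaussianBandit h (gapMeans p γ Δ b)) T := by
  set ν := gaussianBandit h (gapMeans p γ Δ b) with hν
  have hmean (a : Fin n) : ν.mean a = if a = b then Δ else 0 := by
    rw [hν, gaussianBandit_mean, sum_mul_gapMeans h]
  have hbest : Δ ≤ ν.bestMean := by
    have := le_ciSup (Set.finite_range ν.mean).bddAbove b
    rwa [hmean, if_pos rfl] at this
  have hreg (x : Fin T → Round n K) : regret ν x = T * ν.bestMean - Δ * pullCount b x := by
    simp only [regret, hmean, pullCount, Finset.mul_sum, Finset.sum_sub_distrib]
    simp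
  have hNint := integrable_pullCount b (histLaw π ν T)
  have : expRegret π ν T = T * ν.bestMean - Δ * ∫ x, pullCount b x ∂(histLaw π ν T) := by
    simp_rw [expRegret, hreg]
    rw [integral_sub (integrable_const _) (hNint.const_mul _), integral_const, integral_const_mul]
    simp
  rw [this]
  nlinarith [mul_le_mul_of_nonneg_left hbest (Nat.cast_nonneg (α := ℝ) T)]

/-- The gap used in the lower bound, of order `√(n H / T)`; note `∑ a, 1 / P_a = n / H`. -/
noncomputable def minimaxGap (p γ : Fin K → Fin n → ℝ) (T : ℕ) : ℝ :=
  n / (6 * Real.sqrt (T * ∑ a, 1 / armDifficulty p γ a))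

lemma exists_le_expRegret (h : AdmissibleParams p γ) (hn : 2 ≤ n) (π : Policy n K) (T : ℕ) :
    ∃ b : Fin n, 1 / 24 * Real.sqrt (T * n * harmMean p γ) ≤
      expRegret π (gaussianBandit h (gapMeans p γ (minimaxGap p γ T) b)) T := by
  have hn' : (2 : ℝ) ≤ n := by exact_mod_cast hn
  have : Nonempty (Fin n) := ⟨⟨0, by omega⟩⟩
  rcases Nat.eq_zero_or_pos T with rfl | hT
  · exact ⟨⟨0, by omega⟩, by simp [expRegret, regret]⟩
  have hT' : (0 : ℝ) < T := by exact_mod_cast hT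
  set Q := ∑ a, 1 / armDifficulty p γ a with hQ
  have hQ0 : 0 < Q := Finset.sum_pos (fun a _ => one_div_pos.2 (armDifficulty_pos h a))
    Finset.univ_nonempty
  set R := Real.sqrt (T * Q) with hR
  have hR0 : 0 < R := Real.sqrt_pos.2 (mul_pos hT' hQ0)
  have hR2 : R ^ 2 = T * Q := Real.sq_sqrt (mul_pos hT' hQ0).le
  set Δ := minimaxGap p γ T with hΔ
  have hΔR : Δ = n / (6 * R) := rfl
  have hΔ0 : 0 < Δ := by rw [hΔR]; positivity
  let E₀ : Fin n → ℝ := fun b => ∫ x, pullCount b x ∂(histLaw π (gaussianBandit h fun _ _ => 0) T)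
  let E : Fin n → ℝ := fun b =>
    ∫ x, pullCount b x ∂(histLaw π (gaussianBandit h (gapMeans p γ Δ b)) T)
  have hE₀ : ∑ b, E₀ b = T := by
    simp only [E₀]
    rw [← integral_finsetSum _ fun b _ => integrable_pullCount b _]
    simp [sum_pullCount]
  -- The weight is proportional to `1 / P_b`, which makes the coefficient of `E₀ b` independent
  -- of `b`; the factor `n / (12 * Q)` balances the two error terms.
  have hE (b : Fin n) : E b ≤ E₀ b + T * (3 * Q * Δ ^ 2 / n * E₀ b +
      n / (6 * Q) * (1 / armDifficulty p γ b)) := by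
    have hP := armDifficulty_pos h b
    have key := integral_pullCount_le h π T Δ b
      (s := n / (12 * Q) * (1 / armDifficulty p γ b)) (by positivity)
    refine key.trans_eq ?_
    change E₀ b + T * (_ * E₀ b / _ + _) = _
    field_simp
    ring
  have hsum : ∑ b, E b ≤ ∑ _b : Fin n, 3 / 4 * (T : ℝ) := by
    have hs : ∑ b, E b ≤ T + T * (3 * Q * Δ ^ 2 / n * T + n / (6 * Q) * Q) := by
      refine (Finset.sum_le_sum fun b _ => hE b).trans_eq ?_
      rw [Finset.sum_add_distrib, ← Finset.mul_sum, Finset.sum_add_distrib, ← Finset.mul_sum,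
        ← Finset.mul_sum, hE₀]
    have e : 3 * Q * Δ ^ 2 / n * T = n / 12 := by
      rw [hΔR, div_pow, mul_pow, hR2]
      field_simp
      norm_num
    have e' : n / (6 * Q) * Q = (n : ℝ) / 6 := by field_simp
    rw [e, e'] at hs
    simp only [Finset.sum_const, Finset.card_univ, Fintype.card_fin, nsmul_eq_mul]
    nlinarith
  obtain ⟨b, -, hb⟩ := Finset.exists_le_of_sum_le Finset.univ_nonempty hsum
  refine ⟨b, le_trans ?_ (le_expRegret_gapMeans h π T Δ b)⟩
  have hsqrt : Real.sqrt (T * n * harmMean p γ) = n * T / R := by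
    rw [Real.sqrt_eq_iff_mul_self_eq_of_pos (by positivity)]
    change _ = T * n * (n / Q)
    field_simp
    rw [hR2]
  change E b ≤ _ at hb
  change _ ≤ Δ * (T - E b)
  calc _ = Δ * (T - 3 / 4 * T) := by rw [hsqrt, hΔR]; field_simp; norm_num
    _ ≤ _ := by gcongr

lemma gapMeans_nonneg (h : AdmissibleParams p γ) {Δ : ℝ} (hΔ : 0 ≤ Δ) (b : Fin n) (m : Fin K)
    (a : Fin n) : 0 ≤ gapMeans p γ Δ b m a := by
  unfold gapMeans
  split_ifs
  · exact div_nonneg hΔ (mul_pos (h.γ_pos m b) (armDifficulty_pos h b)).le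
  · exact le_rfl

lemma minimaxGap_nonneg (p γ : Fin K → Fin n → ℝ) (T : ℕ) : 0 ≤ minimaxGap p γ T := by
  unfold minimaxGap
  positivity

lemma tendsto_minimaxGap (h : AdmissibleParams p γ) (hn : 2 ≤ n) :
    Filter.Tendsto (minimaxGap p γ) Filter.atTop (nhds 0) := by
  have : Nonempty (Fin n) := ⟨⟨0, by omega⟩⟩
  have hQ0 : 0 < ∑ a, 1 / armDifficulty p γ a :=
    Finset.sum_pos (fun a _ => one_div_pos.2 (armDifficulty_pos h a)) Finset.univ_nonempty
  refine Filter.Tendsto.const_div_atTop (Filter.Tendsto.const_mul_atTop (by norm_num)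
    (Real.tendsto_sqrt_atTop.comp ?_)) _
  exact tendsto_natCast_atTop_atTop.atTop_mul_const hQ0

lemma eventually_gapMeans_le_one (h : AdmissibleParams p γ) (hn : 2 ≤ n) :
    ∀ᶠ T in Filter.atTop, ∀ b m a, gapMeans p γ (minimaxGap p γ T) b m a ≤ 1 := by
  refine Filter.eventually_all.2 fun b => Filter.eventually_all.2 fun m => ?_
  have hpos := mul_pos (h.γ_pos m b) (armDifficulty_pos h b)
  filter_upwards [(tendsto_minimaxGap h hn).eventually_le_const hpos] with T hT a
  unfold gapMeans
  split_ifs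
  · exact (div_le_one hpos).2 hT
  · exact zero_le_one

end alternatives

/-! ### Constant observation probability -/

section constantObsProb

variable {p γ : Fin K → Fin n → ℝ}

lemma armDifficulty_of_const (h : AdmissibleParams p γ) {γ₀ : ℝ} (hγ : ∀ m a, γ m a = γ₀)
    (a : Fin n) : armDifficulty p γ a = 1 / γ₀ := by
  simp only [armDifficulty, hγ]
  rw [← Finset.sum_div, h.p_sum]

lemma arithMean_of_const (h : AdmissibleParams p γ) (hn : 2 ≤ n) {γ₀ : ℝ}
    (hγ : ∀ m a, γ m a = γ₀) : arithMean p γ = 1 / γ₀ := by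
  have : (n : ℝ) ≠ 0 := by norm_cast; omega
  simp only [arithMean, armDifficulty_of_const h hγ, Finset.sum_const, Finset.card_univ,
    Fintype.card_fin, nsmul_eq_mul]
  exact mul_div_cancel_left₀ _ this

lemma harmMean_of_const (h : AdmissibleParams p γ) (hn : 2 ≤ n) {γ₀ : ℝ}
    (hγ : ∀ m a, γ m a = γ₀) : harmMean p γ = 1 / γ₀ := by
  have : (n : ℝ) ≠ 0 := by norm_cast; omega
  simp only [harmMean, armDifficulty_of_const h hγ, Finset.sum_const, Finset.card_univ,
    Fintype.card_fin, nsmul_eq_mul, one_div_one_div]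
  exact div_mul_cancel_left₀ this _ |>.trans (one_div _).symm

end constantObsProb

end MissingBandit
open MissingBandit in
theorem mainTheorem5 :
    ∃ c : ℝ, 0 < c ∧ ∀ (n K : ℕ), 2 ≤ n → ∀ p γ : Fin K → Fin n → ℝ, AdmissibleParams p γ →
      (∀ (T : ℕ) (π : Policy n K), ∃ ν : Instance n K,
        ν.IsMAR ∧ ν.HasParams p γ ∧ ν.IsSubGaussian ∧ (∀ m a, 0 ≤ ν.condMean m a) ∧
          c * Real.sqrt (T * n * harmMean p γ) ≤ expRegret π ν T) ∧
      (∃ T₀ : ℕ, ∀ T : ℕ, T₀ ≤ T → ∀ π : Policy n K, ∃ ν : Instance n K,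
        ν.IsMAR ∧ ν.HasParams p γ ∧ ν.IsSubGaussian ∧
          (∀ m a, ν.condMean m a ∈ Set.Icc (0 : ℝ) 1) ∧
          c * Real.sqrt (T * n * harmMean p γ) ≤ expRegret π ν T) ∧
      (∀ γ₀ : ℝ, (∀ m a, γ m a = γ₀) →
        arithMean p γ = harmMean p γ ∧ harmMean p γ = 1 / γ₀ ∧
          ∀ (α : ℝ) (T : ℕ), 1 < α → 1 ≤ T →
            upperRate p γ α T =
              Real.sqrt (α * Real.log T) * Real.sqrt (T * n * harmMean p γ)) := by
  refine ⟨1 / 24, by norm_num, fun n K hn p γ h => ⟨fun T π => ?_, ?_, fun γ₀ hγ => ?_⟩⟩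
  · obtain ⟨b, hb⟩ := exists_le_expRegret h hn π T
    refine ⟨_, gaussianBandit_isMAR h _, gaussianBandit_hasParams h _,
      gaussianBandit_isSubGaussian h _, fun m a => ?_, hb⟩
    rw [gaussianBandit_condMean]
    exact gapMeans_nonneg h (minimaxGap_nonneg p γ T) b m a
  · obtain ⟨T₀, hT₀⟩ := Filter.eventually_atTop.1 (eventually_gapMeans_le_one h hn)
    refine ⟨T₀, fun T hT π => ?_⟩
    obtain ⟨b, hb⟩ := exists_le_expRegret h hn π T
    refine ⟨_, gaussianBandit_isMAR h _, gaussianBandit_hasParams h _,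
      gaussianBandit_isSubGaussian h _, fun m a => ?_, hb⟩
    rw [gaussianBandit_condMean]
    exact ⟨gapMeans_nonneg h (minimaxGap_nonneg p γ T) b m a, hT₀ T hT b m a⟩
  · have hS := arithMean_of_const h hn hγ
    have hH := harmMean_of_const h hn hγ
    refine ⟨hS.trans hH.symm, hH, fun α T hα hT => ?_⟩
    have hlog : 0 ≤ Real.log T := Real.log_nonneg (by exact_mod_cast hT)
    rw [← Real.sqrt_mul (mul_nonneg (by linarith) hlog), upperRate, hS, hH]
    congr 1
    ring
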